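/- **Definitions.** Let $I$ be an infinite set, and let $\Delta_I\subset[0,1]^I$ be the convex hull of the unit vectors $e_k$, $k\in I$, with the product topology. For a set $Y$ put $\Delta(Y)=\Delta_I\times Y^I$ (formal convex combinations), and for $A\subset Y$ put $\Delta(A)=\{(d,a)\in\Delta(Y): d_i\neq 0\Rightarrow a_i\in A\}$. Let $Y$ be a uniform space with an open base $\mathcal B$ of its uniformity of the smallest possible cardinality, and write $B(A,W)=\{y:(x,y)\in W\text{ for some }x\in A\}$. Let $Z$ be the set $Y$ with some topology, $\mathcal V$ a class of multifunctions between topological spaces, $\mathcal A$ a family of nonempty subsets of $Y$, $\mathrm{conv}$ a map from $\mathcal A$ to the nonempty subsets of $Y$, and $Q'\subset\Delta(Y)$ a set containing $\Delta(B(A,W))$ for all $A\in\mathcal A$, $W\in\mathcal B$. Given a multifunction $C:Q'\to Y$, the triple $(Y,C,Z)$ is a *convexity* associated with $\mathcal A,\mathrm{conv},\mathcal V,Q'$ if * (D) for every $a\in Y^I$ and every finite-dimensional face $\Delta_n$ of $\Delta_I$ (the convex hull of finitely many, at least one, of the $e_k$) with $\Delta_n\times\{a\}\subset Q'$, the multifunction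 $C(\cdot,a):\Delta_n\to Z$ belongs to $\mathcal V$; * (E) for every $U\in\mathcal B$ there is $W\in\mathcal B$ such that $C(q)\subset B(\mathrm{conv}(A),U)$ for all $A\in\mathcal A$ and all $q\in\Delta(B(A,W))$. It is *global* if $Q'=\Delta(Y)$. A compact Hausdorff space $Y$ is an *ANR* if, whenever it is embedded as a closed subspace of a compact Hausdorff space $X$, it is a retract of an open neighbourhood of itself in $X$. **Theorem.** Let $Y$ be a compact Hausdorff ANR, with its unique compatible uniformity and any open base $\mathcal B$ of it of the smallest cardinality. Let $\mathcal V$ be the class of all upper semicontinuous multifunctions each of whose values is either a singleton or the whole target space (so, for multifunctions into $Y$, a singleton or $Y$). Then there exists a multifunction $C:\Delta(Y)\to Y$ such that $(Y,C,Y)$ is a global convexity associated with $\mathcal A=\{\{y\}:y\in Y\}$, $\mathrm{conv}(\{y\})=\{y\}$ for all $y\in Y$, and $\mathcal V$. -/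

import Mathlib

open Set Topology Uniformity

universe u v

open Classical in
/-- The (possibly infinite-dimensional) simplex `Δ_ω ⊆ [0,1]^I` spanned by the unit vectors `e_k`,
`k ∈ I`: their convex hull, with the topology induced by the product topology of `I → ℝ`. -/
def infSimplex (I : Type v) : Set (I → ℝ) :=
  convexHull ℝ (range fun k : I => (Pi.single k (1 : ℝ) : I → ℝ))

/-- The face of `Δ_ω` spanned by the unit vectors `e_k`, `k ∈ K`; for `K` finite with `n + 1`
elements these are the simplices `Δ_n` of `Δ_ω`. -/
def simplexFace {I : Type v} (K : Set I) : Set (infSimplex I) :=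
  {d | ∀ i, i ∉ K → (d : I → ℝ) i = 0}

/-- `Δ(Y) = Δ_ω × Y^ω`: formal convex combinations `(d, a)` of points of `Y`. -/
abbrev FormalComb (I : Type v) (Y : Type u) : Type (max u v) :=
  infSimplex I × (I → Y)

/-- `Δ(A)`: formal convex combinations of elements of `A`. -/
def formalCombOf (I : Type v) {Y : Type u} (A : Set Y) : Set (FormalComb I Y) :=
  {p | ∀ i, (p.1 : I → ℝ) i ≠ 0 → p.2 i ∈ A}

/-- `B(A, W)`: the union of the balls `{y | (x, y) ∈ W}`, `x ∈ A`. -/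
def uniformNhd {Y : Type u} (A : Set Y) (W : Set (Y × Y)) : Set Y :=
  ⋃ x ∈ A, UniformSpace.ball x W

/-- A base of the uniformity of `Y` that consists of open entourages. -/
def IsOpenUniformBase {Y : Type u} [UniformSpace Y] (B : Set (Set (Y × Y))) : Prop :=
  (𝓤 Y).HasBasis (fun V : Set (Y × Y) => V ∈ B) id ∧ ∀ V ∈ B, IsOpen V

/-- An open uniform base of the smallest possible cardinality. -/
def IsMinimalOpenUniformBase {Y : Type u} [UniformSpace Y] (B : Set (Set (Y × Y))) : Prop :=
  IsOpenUniformBase B ∧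
    ∀ B' : Set (Set (Y × Y)), IsOpenUniformBase B' → Cardinal.mk B ≤ Cardinal.mk B'

/-- A class of multifunctions `F : X → Z` between topological spaces. -/
abbrev MultifunctionClass : Type (max (u + 1) (v + 1)) :=
  ∀ (X : Type v) (Z : Type u) [TopologicalSpace X] [TopologicalSpace Z], (X → Set Z) → Prop

/-- `(Y, C, Z)` is a convexity associated with `𝒜`, `conv`, `𝒱`, `Q'`. Here `Y` is a uniform space
with minimal open base `B`, and `Z` is the set `Y` with a further topology `tZ`. -/
structure IsConvexity (I : Type v) {Y : Type u} [UniformSpace Y] (B : Set (Set (Y × Y)))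
    (tZ : TopologicalSpace Y) (𝒱 : MultifunctionClass.{u, v}) (𝒜 : Set (Set Y))
    (conv : 𝒜 → Set Y) (Q' : Set (FormalComb I Y)) (C : Q' → Set Y) : Prop where
  base : IsMinimalOpenUniformBase B
  admissible_nonempty : ∀ A ∈ 𝒜, A.Nonempty
  conv_nonempty : ∀ A : 𝒜, (conv A).Nonempty
  domain : ∀ A ∈ 𝒜, ∀ W ∈ B, formalCombOf I (uniformNhd A W) ⊆ Q'
  /-- Condition (D): on each finite-dimensional face, `C(·, a)` belongs to `𝒱`, as a multifunction
  into `Z`. -/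
  mem_class : ∀ (a : I → Y) (K : Finset I), K.Nonempty →
    ∀ h : ∀ d ∈ simplexFace (K : Set I), (d, a) ∈ Q',
      @𝒱 (simplexFace (K : Set I)) Y inferInstance tZ (fun d => C ⟨(d.1, a), h d.1 d.2⟩)
  /-- Condition (E): `C(Δ(B(A, W))) ⊆ B(conv A, U)`, with `W` independent of `A`. -/
  uniform_hull : ∀ U ∈ B, ∃ W ∈ B, ∀ A : 𝒜, ∀ q : Q',
    (q : FormalComb I Y) ∈ formalCombOf I (uniformNhd (A : Set Y) W) →
      C q ⊆ uniformNhd (conv A) U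

/-- The class of upper semicontinuous multifunctions each of whose values is a singleton or the
whole target space. -/
def uscSingletonOrWhole : MultifunctionClass.{u, v} :=
  fun X Z _ _ F => UpperHemicontinuous F ∧ ∀ x : X, (∃ z : Z, F x = {z}) ∨ F x = univ

/-- Absolute neighbourhood retract, for a compact Hausdorff space `Y`: whenever `Y` is embedded as
a closed subspace of a compact Hausdorff space `X`, its image is a retract of an open
neighbourhood of it in `X` (the retraction is written as a left inverse of the embedding).
As `Y` embeds into the cube `[0,1]^{C(Y,[0,1])}`, spaces `X` of the universe of `Y` suffice. -/
def IsCompactANR (Y : Type u) [TopologicalSpace Y] : Prop :=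
  ∀ (X : Type u) [TopologicalSpace X] [CompactSpace X] [T2Space X] (e : Y → X),
    IsClosedEmbedding e →
      ∃ N : Set X, IsOpen N ∧ ∃ he : ∀ y, e y ∈ N,
        ∃ r : N → Y, Continuous r ∧ ∀ y, r ⟨e y, he y⟩ = y

/-! The space `Y` sits in the cube `[0,1]^{C(Y,[0,1])}`, where formal combinations have genuine
barycentres, and the ANR property gives a retraction `r` onto `Y` of an open set `N` of the cube.
Let `C q` be `{r b}` if the barycentre `b` of `q` lies in `N`, and all of `Y` otherwise. Condition
(D) holds because `b` is continuous on finite faces and `N` is open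
(`uscSingletonOrWhole_of_partial`). For (E), points near `y` have a barycentre near the image of `y`
(`exists_cubeBarycenter_close`), hence in `N` and sent by `r` close to `y`
(`exists_retraction_close`). -/

section InfSimplex

variable {I : Type v}

lemma infSimplex_subset :
    infSimplex I ⊆ {d | (∀ i, 0 ≤ d i) ∧ ∑ᶠ i, d i = 1} := by
  classical
  refine convexHull_min ?_ ?_
  · rintro _ ⟨k, rfl⟩
    refine ⟨fun i => ?_, ?_⟩
    · by_cases h : i = k
      · subst h; simp
      · simp [h]
    · rw [finsum_eq_single _ k fun i hi => by simp [hi]]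
      simp
  · rintro x ⟨hx, hx1⟩ y ⟨hy, hy1⟩ s t hs ht hst
    -- A `finsum` over an infinite support is `0`, so total `1` already encodes finite support.
    have hfin : ∀ z : I → ℝ, ∑ᶠ i, z i = 1 → (Function.support z).Finite := fun z hz => by
      by_contra h
      rw [finsum_of_infinite_support h] at hz
      exact zero_ne_one hz
    have hsmul : ∀ (c : ℝ) (z : I → ℝ), ∑ᶠ i, z i = 1 →
        (Function.support fun i => c * z i).Finite := fun c z hz =>
      (hfin z hz).subset (Function.support_mul_subset_right _ _)
    refine ⟨fun i => ?_, ?_⟩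
    · have := mul_nonneg hs (hx i)
      have := mul_nonneg ht (hy i)
      simp only [Pi.add_apply, Pi.smul_apply, smul_eq_mul]
      linarith
    · simp only [Pi.add_apply, Pi.smul_apply, smul_eq_mul]
      rw [finsum_add_distrib (hsmul s x hx1) (hsmul t y hy1), ← mul_finsum', ← mul_finsum',
        hx1, hy1]
      · simpa using hst
      · exact hfin y hy1
      · exact hfin x hx1

lemma finsum_mul_mem_of_mem_infSimplex {s : Set ℝ} (hs : Convex ℝ s) (d : infSimplex I)
    {z : I → ℝ} (hz : ∀ i, (d : I → ℝ) i ≠ 0 → z i ∈ s) : ∑ᶠ i, (d : I → ℝ) i * z i ∈ s :=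
  hs.finsum_mem (infSimplex_subset d.2).1 (infSimplex_subset d.2).2 hz

end InfSimplex

section Barycenter

variable {I : Type v} {Y : Type u} [TopologicalSpace Y]

/-- The evaluation map of `Y` into the cube `[0,1]^{C(Y,[0,1])}`. -/
def cubeEval (Y : Type u) [TopologicalSpace Y] (y : Y) : C(Y, unitInterval) → unitInterval :=
  fun f => f y

lemma continuous_cubeEval : Continuous (cubeEval Y) :=
  continuous_pi fun f => f.continuous

lemma isClosedEmbedding_cubeEval [CompactSpace Y] [T2Space Y] :
    IsClosedEmbedding (cubeEval Y) := by
  refine continuous_cubeEval.isClosedEmbedding fun x y hxy => ?_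
  by_contra hne
  obtain ⟨f, hf, hfx, hfy⟩ :=
    CompletelyRegularSpace.completely_regular x {y} isClosed_singleton hne
  have h := congrFun hxy ⟨f, hf⟩
  have hfy' : f y = 1 := hfy rfl
  simp only [cubeEval, ContinuousMap.coe_mk, hfx, hfy'] at h
  exact zero_ne_one h

/-- The value in the cube `[0,1]^{C(Y,[0,1])}` of a formal convex combination of points of `Y`. -/
noncomputable def cubeBarycenter (q : FormalComb I Y) : C(Y, unitInterval) → unitInterval :=
  fun f => ⟨∑ᶠ i, (q.1 : I → ℝ) i * (f (q.2 i) : ℝ),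
    finsum_mul_mem_of_mem_infSimplex (convex_Icc 0 1) q.1 fun i _ => (f (q.2 i)).2⟩

lemma continuous_cubeBarycenter_face (a : I → Y) (K : Finset I) :
    Continuous fun d : simplexFace (K : Set I) => cubeBarycenter ((d : infSimplex I), a) := by
  refine continuous_pi fun f => Continuous.subtype_mk ?_ _
  have h : ∀ d : simplexFace (K : Set I), ∑ᶠ i, ((d : infSimplex I) : I → ℝ) i * (f (a i) : ℝ) =
      ∑ i ∈ K, ((d : infSimplex I) : I → ℝ) i * (f (a i) : ℝ) := fun d =>
    finsum_eq_sum_of_support_subset _ fun i hi => by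
      by_contra hiK
      exact hi (by simp [d.2 i hiK])
  simp only [h]
  exact continuous_finsetSum _ fun i _ =>
    ((continuous_apply i).comp (continuous_subtype_val.comp continuous_subtype_val)).mul
      continuous_const

end Barycenter

/-- A product entourage constrains only finitely many coordinates `f`; each is uniformly continuous
on `Y`, and balls in `ℝ` are convex. -/
lemma exists_cubeBarycenter_close {Y : Type u} [UniformSpace Y] [CompactSpace Y] (I : Type v)
    {V : Set ((C(Y, unitInterval) → unitInterval) × (C(Y, unitInterval) → unitInterval))}
    (hV : V ∈ 𝓤 (C(Y, unitInterval) → unitInterval)) :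
    ∃ W ∈ 𝓤 Y, ∀ (y : Y) (q : FormalComb I Y),
      q ∈ formalCombOf I (UniformSpace.ball y W) → (cubeEval Y y, cubeBarycenter q) ∈ V := by
  rw [Pi.uniformity, Filter.mem_iInf'] at hV
  obtain ⟨F, hF, V', hV', -, rfl, -⟩ := hV
  have hcoord : ∀ f : C(Y, unitInterval), ∃ W ∈ 𝓤 Y, ∀ (y : Y) (q : FormalComb I Y),
      q ∈ formalCombOf I (UniformSpace.ball y W) → (cubeEval Y y, cubeBarycenter q) ∈ V' f := by
    intro f
    obtain ⟨S, hS, hSV⟩ := Filter.mem_comap.1 (hV' f)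
    obtain ⟨ε, hε, hεS⟩ := Metric.mem_uniformity_dist.1 hS
    refine ⟨_, (CompactSpace.uniformContinuous_of_continuous f.continuous)
      (Metric.dist_mem_uniformity hε), fun y q hq => hSV (hεS ?_)⟩
    rw [dist_comm]
    refine finsum_mul_mem_of_mem_infSimplex (convex_ball (f y : ℝ) ε) q.1 fun i hi => ?_
    have h : dist (f y) (f (q.2 i)) < ε := hq i hi
    rw [dist_comm] at h
    exact h
  choose W hW hWV using hcoord
  exact ⟨⋂ f ∈ F, W f, (Filter.biInter_mem hF).2 fun f _ => hW f, fun y q hq =>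
    mem_iInter₂.2 fun f hf => hWV f y q fun i hi => mem_iInter₂.1 (hq i hi) f hf⟩

lemma exists_retraction_close {X : Type u} {Y : Type v} [UniformSpace X] [UniformSpace Y]
    [CompactSpace Y] {e : Y → X} (he : Continuous e) {N : Set X} (hN : IsOpen N)
    (heN : ∀ y, e y ∈ N) {r : N → Y} (hr : Continuous r) (hre : ∀ y, r ⟨e y, heN y⟩ = y)
    {U : Set (Y × Y)} (hU : U ∈ 𝓤 Y) :
    ∃ V ∈ 𝓤 X, ∀ y x, (e y, x) ∈ V → ∃ hx : x ∈ N, (y, r ⟨x, hx⟩) ∈ U := by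
  obtain ⟨V₁, hV₁, -, hV₁N⟩ := lebesgue_number_of_compact_open (isCompact_range he) hN
    (range_subset_iff.2 heN)
  -- `N` need not be compact, but uniformity is needed only for pairs with one point in the compact
  -- image of `Y`.
  have h := (isCompact_range (he.subtype_mk heN)).uniformContinuousAt_of_continuousAt r
    (fun _ _ => hr.continuousAt) hU
  rw [uniformity_subtype, Filter.mem_comap] at h
  obtain ⟨V₂, hV₂, hV₂r⟩ := h
  refine ⟨V₁ ∩ V₂, Filter.inter_mem hV₁ hV₂, fun y x hyx => ?_⟩
  have hx : x ∈ N := hV₁N _ (mem_range_self y) hyx.1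
  have hU' := @hV₂r (⟨e y, heN y⟩, ⟨x, hx⟩) hyx.2 (mem_range_self y)
  rw [hre] at hU'
  exact ⟨hx, hU'⟩

/-- The singleton-or-whole multifunction induced by a partial map `r` with open domain is upper
semicontinuous. -/
lemma uscSingletonOrWhole_of_partial {T : Type v} {X Y : Type u} [TopologicalSpace T]
    [TopologicalSpace X] [TopologicalSpace Y] {m : T → X} (hm : Continuous m) {N : Set X}
    (hN : IsOpen N) {r : N → Y} (hr : Continuous r) :
    uscSingletonOrWhole T Y fun t => {y | ∀ h : m t ∈ N, r ⟨m t, h⟩ = y} := by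
  refine ⟨upperHemicontinuous_iff_forall_isOpen.2 fun t u hu htu => ?_, fun t => ?_⟩
  · by_cases ht : m t ∈ N
    · have hopen : IsOpen (m ⁻¹' (Subtype.val '' (r ⁻¹' u))) :=
        (hN.isOpenMap_subtype_val _ (hu.preimage hr)).preimage hm
      have htm : t ∈ m ⁻¹' (Subtype.val '' (r ⁻¹' u)) :=
        ⟨⟨m t, ht⟩, htu fun _ => rfl, rfl⟩
      filter_upwards [hopen.mem_nhds htm] with s hs y hy
      obtain ⟨⟨x, hx⟩, hxu, rfl⟩ := hs
      exact hy hx ▸ hxu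
    -- Off `N` the value at `t` is everything, so `u` is too.
    · exact Filter.Eventually.of_forall fun s y _ => htu fun h => absurd h ht
  · by_cases ht : m t ∈ N
    · exact Or.inl ⟨r ⟨m t, ht⟩, ext fun y => ⟨fun h => (h ht).symm, fun h _ => h.symm⟩⟩
    · exact Or.inr (eq_univ_of_forall fun y h => absurd h ht)

theorem theorem5p2 (I : Type v) [Infinite I] (Y : Type u) [UniformSpace Y] [CompactSpace Y]
    [T2Space Y] (hY : IsCompactANR Y) (B : Set (Set (Y × Y))) (hB : IsMinimalOpenUniformBase B) :
    ∃ (Q' : Set (FormalComb I Y)) (C : Q' → Set Y), Q' = univ ∧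
      IsConvexity I B (UniformSpace.toTopologicalSpace : TopologicalSpace Y) uscSingletonOrWhole
        (range fun y : Y => ({y} : Set Y)) (fun A => (A : Set Y)) Q' C := by
  obtain ⟨N, hN, heN, r, hr, hre⟩ := hY _ (cubeEval Y) isClosedEmbedding_cubeEval
  -- The implication is vacuous off `N`, which makes the value there all of `Y`.
  refine ⟨univ, fun q => {y | ∀ h : cubeBarycenter q.1 ∈ N, r ⟨_, h⟩ = y}, rfl, hB, ?_, ?_,
    fun _ _ _ _ => subset_univ _, ?_, ?_⟩
  · rintro _ ⟨y, rfl⟩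
    exact singleton_nonempty y
  · rintro ⟨_, y, rfl⟩
    exact singleton_nonempty y
  · intro a K _ _
    exact uscSingletonOrWhole_of_partial (continuous_cubeBarycenter_face a K) hN hr
  · intro U hU
    obtain ⟨V, hV, hVU⟩ := exists_retraction_close continuous_cubeEval hN heN hr hre
      (hB.1.1.mem_of_mem hU)
    obtain ⟨W', hW', hW'V⟩ := exists_cubeBarycenter_close I hV
    obtain ⟨W, hW, hWW'⟩ := hB.1.1.mem_iff.1 hW'
    refine ⟨W, hW, ?_⟩
    rintro ⟨_, y, rfl⟩ ⟨q, _⟩ hq z hz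
    simp only [uniformNhd, biUnion_singleton] at hq ⊢
    obtain ⟨hx, hxU⟩ := hVU y _ (hW'V y q fun i hi => hWW' (hq i hi))
    have hz' : r ⟨cubeBarycenter q, hx⟩ = z := hz hx
    exact hz' ▸ hxU
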